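/- Let $K$ be an algebraically closed field and let $L\ge 1$, $r\ge 2$ and $d$ be integers. Let $\Lambda=KQ/\langle\text{all paths of length }L+1\rangle$ be the local truncated path algebra of Loewy length $L+1$, where $Q$ is the quiver with a single vertex and $r$ loops (so $KQ$ is the free algebra on $r$ generators), and let $J$ be the Jacobson radical of $\Lambda$. Let $\operatorname{Rep}_d(\Lambda)$ be the affine variety, with its Zariski topology, of all $r$-tuples $(A_1,\dots,A_r)$ of $d\times d$ matrices over $K$ such that every product of $L+1$ of the $A_i$ vanishes; such a tuple corresponds to the left $\Lambda$-module $M=K^d$ on which the $i$-th loop acts as $A_i$. Suppose $d>L+1$, and let $\mathcal C$ be any irreducible component of $\operatorname{Rep}_d(\Lambda)$. Then: 1. There is a dense open subset of $\mathcal C$ such that every module $M$ corresponding to a point of it satisfies $J^Lx\neq 0$ for all $x\in M\setminus JM$. 2. In particular, there is a dense open subset $\mathfrak U\subseteq\mathcal C$ such that every module $M$ corresponding to a point of $\mathfrak U$ decomposes as a finite direct sum of indecomposable submodules all of which have Loewy length $L+1$, and every indecomposable direct summand of such an $M$ has Loewy length $L+1$. (The Loewy length of a module $N$ is the least $n$ with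 $J^nN=0$.) -/

import Mathlib

namespace LocalTruncated

/-- The Zariski topology on the affine space `K^σ`: the closed sets are the common zero sets of
ideals of polynomials. -/
@[reducible]
def zariskiTopology (K σ : Type*) [Field K] : TopologicalSpace (σ → K) :=
  TopologicalSpace.ofClosed
    {V | ∃ I : Ideal (MvPolynomial σ K), V = MvPolynomial.zeroLocus K I}
    ⟨⊤, (MvPolynomial.zeroLocus_top (k := K) (K := K)).symm⟩
    (by
      intro A hA
      refine ⟨sSup {I | MvPolynomial.zeroLocus K I ∈ A}, ?_⟩
      ext x
      simp only [Set.mem_sInter]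
      constructor
      · intro h
        have hle : ({x} : Set (σ → K)) ≤ MvPolynomial.zeroLocus K
            (sSup {I : Ideal (MvPolynomial σ K) | MvPolynomial.zeroLocus K I ∈ A}) := by
          rw [MvPolynomial.le_zeroLocus_iff_le_vanishingIdeal]
          refine sSup_le fun I hI => ?_
          rw [← MvPolynomial.le_zeroLocus_iff_le_vanishingIdeal]
          exact Set.singleton_subset_iff.mpr (h _ hI)
        exact hle rfl
      · intro h V hV
        obtain ⟨I, rfl⟩ := hA hV
        exact MvPolynomial.zeroLocus_anti_mono
          (le_sSup (show I ∈ {I : Ideal (MvPolynomial σ K) |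
            MvPolynomial.zeroLocus K I ∈ A} from hV)) h)
    (by
      rintro V ⟨I, rfl⟩ W ⟨I', rfl⟩
      refine ⟨I * I', ?_⟩
      ext x
      simp only [Set.mem_union, MvPolynomial.mem_zeroLocus_iff]
      constructor
      · rintro (h | h) p hp
        · exact h p (Ideal.mul_le_inf hp).1
        · exact h p (Ideal.mul_le_inf hp).2
      · intro h
        by_contra! hcon
        obtain ⟨⟨p, hp, hp0⟩, ⟨q, hq, hq0⟩⟩ := hcon
        have hpq := h (p * q) (Ideal.mul_mem_mul hp hq)
        rw [map_mul] at hpq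
        exact (mul_ne_zero hp0 hq0) hpq)

/-- The relations of the truncated path algebra: in the free algebra on `r` letters, which is the
path algebra of the quiver with one vertex and `r` loops, every path of length `L + 1` is set to
zero. -/
def pathRel (K : Type*) [Field K] (r L : ℕ) :
    FreeAlgebra K (Fin r) → FreeAlgebra K (Fin r) → Prop :=
  fun a b => ∃ w : List (Fin r), w.length = L + 1 ∧
    a = (w.map (FreeAlgebra.ι K)).prod ∧ b = 0

/-- The local truncated path algebra `Λ = KQ / ⟨paths of length L + 1⟩`, where `Q` is the quiver
with one vertex and `r` loops. -/
def Lam (K : Type*) [Field K] (r L : ℕ) : Type _ := RingQuot (pathRel K r L)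

instance (K : Type*) [Field K] (r L : ℕ) : Ring (Lam K r L) :=
  inferInstanceAs (Ring (RingQuot (pathRel K r L)))

instance (K : Type*) [Field K] (r L : ℕ) : Algebra K (Lam K r L) :=
  inferInstanceAs (Algebra K (RingQuot (pathRel K r L)))

/-- The class in `Λ` of the `i`-th loop. -/
def Lam.arrow (K : Type*) [Field K] (r L : ℕ) (i : Fin r) : Lam K r L :=
  RingQuot.mkAlgHom K (pathRel K r L) (FreeAlgebra.ι K i)

/-- The affine variety `Rep_d(Λ)`: the `r`-tuples of `d × d` matrices all of whose
`(L + 1)`-fold products vanish. -/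
@[ext]
structure RepVar (K : Type*) [Field K] (r L d : ℕ) where
  /-- the matrices of the tuple -/
  mat : Fin r → Matrix (Fin d) (Fin d) K
  /-- all `(L + 1)`-fold products vanish -/
  rel : ∀ w : List (Fin r), w.length = L + 1 → (w.map mat).prod = 0

/-- The list of all matrix entries of a point of `Rep_d(Λ)`, a point of affine `r d²`-space. -/
def RepVar.coords {K : Type*} [Field K] {r L d : ℕ} (x : RepVar K r L d) :
    Fin r × Fin d × Fin d → K :=
  fun p => x.mat p.1 p.2.1 p.2.2

/-- The Zariski topology on `Rep_d(Λ)`, as a subset of affine `r d²`-space. -/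
instance (K : Type*) [Field K] (r L d : ℕ) : TopologicalSpace (RepVar K r L d) :=
  TopologicalSpace.induced RepVar.coords (zariskiTopology K (Fin r × Fin d × Fin d))

/-- The algebra homomorphism from `Λ` to the `d × d` matrices determined by a point of
`Rep_d(Λ)`; it sends the `i`-th loop to the `i`-th matrix. -/
noncomputable def RepVar.toAlgHom {K : Type*} [Field K] {r L d : ℕ} (x : RepVar K r L d) :
    Lam K r L →ₐ[K] Matrix (Fin d) (Fin d) K :=
  RingQuot.liftAlgHom K ⟨FreeAlgebra.lift K x.mat, by
    rintro a b ⟨w, hw, rfl, rfl⟩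
    rw [map_zero, map_list_prod, List.map_map]
    have h : (⇑(FreeAlgebra.lift K x.mat) ∘ FreeAlgebra.ι K) = x.mat :=
      FreeAlgebra.ι_comp_lift x.mat
    rw [h]
    exact x.rel w hw⟩

/-- The left `Λ`-module `M_x` attached to a point `x` of `Rep_d(Λ)`: the space `K^d`, on which
`Λ` acts through the matrices of `x`. -/
def RepVar.Mod {K : Type*} [Field K] {r L d : ℕ} (_x : RepVar K r L d) : Type _ := Fin d → K

instance {K : Type*} [Field K] {r L d : ℕ} (x : RepVar K r L d) : AddCommGroup x.Mod :=
  inferInstanceAs (AddCommGroup (Fin d → K))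

noncomputable instance {K : Type*} [Field K] {r L d : ℕ} (x : RepVar K r L d) :
    Module (Lam K r L) x.Mod :=
  Module.compHom (Fin d → K)
    ((Matrix.toLinAlgEquiv' : Matrix (Fin d) (Fin d) K ≃ₐ[K]
      ((Fin d → K) →ₗ[K] (Fin d → K))).toAlgHom.comp x.toAlgHom).toRingHom

/-- The `i`-th loop acts on `M_x = K^d` as multiplication by the `i`-th matrix of `x`. -/
theorem RepVar.arrow_smul {K : Type*} [Field K] {r L d : ℕ} (x : RepVar K r L d) (i : Fin r)
    (m : x.Mod) : Lam.arrow K r L i • m = (x.mat i).mulVec m := by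
  have h : x.toAlgHom (Lam.arrow K r L i) = x.mat i := by
    unfold RepVar.toAlgHom Lam.arrow
    exact (RingQuot.liftAlgHom_mkAlgHom_apply K _ _ _).trans (FreeAlgebra.lift_ι_apply _ _)
  change (x.toAlgHom (Lam.arrow K r L i)).mulVec m = _
  rw [h]

/-- A property of the points of a subset `C` of a topological space holds generically on `C` if
it holds on some dense open subset of `C` (in the subspace topology). -/
def Generically {X : Type*} [TopologicalSpace X] (C : Set X) (P : X → Prop) : Prop :=
  ∃ U : Set C, IsOpen U ∧ Dense U ∧ ∀ x ∈ U, P x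

/-- The Loewy length of a module `M` over a ring `R` with Jacobson radical `J`: the least `n`
with `J ^ n M = 0`. -/
noncomputable def loewyLength (R M : Type*) [Ring R] [AddCommGroup M] [Module R M] : ℕ :=
  sInf {n : ℕ | ((Ring.jacobson R) ^ n : Ideal R) • (⊤ : Submodule R M) = ⊥}

/-- A module is indecomposable if it is nonzero and is not the direct sum of two nonzero
submodules. -/
def Indecomposable (R M : Type*) [Ring R] [AddCommGroup M] [Module R M] : Prop :=
  Nontrivial M ∧ ∀ A B : Submodule R M, IsCompl A B → A = ⊥ ∨ B = ⊥

end LocalTruncated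

/-! For a point `x` with module M, the image of `x.radicalMatrix` is JM and the kernel of
`x.pathMatrix` is the annihilator of J^L in M. Since J^(L+1) = 0, the image always lies in the
kernel. Equality, which is the first claim, therefore means that the two ranks add up to at least d.
This is an open condition (`RepVar.isOpen_rank_add_rank`). In a Noetherian space each irreducible
component contains a nonempty open set of the whole space, so it suffices that the condition is
dense in the whole variety (`RepVar.dense_rank_add_rank`).

For density, start from any tuple T and a filtration F of length L + 1 shifted by T, with layers of
dimension c_k = dim F_k/F_(k+1). If c_(k+1) ≤ r c_k and c_k ≤ r c_(k+1) for all k < L, there is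
another tuple S shifting F whose maps between consecutive layers are jointly surjective and jointly
injective (`exists_shift_jointly_injective_surjective`); then F_1 is both the image and the kernel
above. Shifting F is a linear condition, so the line through T and S stays in the variety, and its
generic point is good.

The radical filtration satisfies the first inequality. The second is reached by repeatedly enlarging
the filtration while keeping the first (`IsShiftedBy.exists_larger`); this is where r ≥ 2 and the
lower bound on d enter.

The second claim follows from the first: by Nakayama a nonzero direct summand N has an element
outside JN, hence outside JM, and J^L does not kill it. -/

namespace LocalTruncated

/-! ### The Jacobson radical of Λ in terms of paths. -/

section Algebra

variable (K : Type*) [Field K] (r L : ℕ)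

/-- The class in `Λ` of a path, given as a word in the loops. -/
def Lam.path (w : List (Fin r)) : Lam K r L := (w.map (Lam.arrow K r L)).prod

theorem Lam.path_append (v w : List (Fin r)) :
    Lam.path K r L (v ++ w) = Lam.path K r L v * Lam.path K r L w := by
  simp [Lam.path]

theorem Lam.path_nil : Lam.path K r L [] = 1 := by simp [Lam.path]

theorem Lam.path_singleton (i : Fin r) : Lam.path K r L [i] = Lam.arrow K r L i := by
  simp [Lam.path]

theorem Lam.path_cons (i : Fin r) (w : List (Fin r)) :
    Lam.path K r L (i :: w) = Lam.arrow K r L i * Lam.path K r L w := by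
  simp [Lam.path]

theorem Lam.path_eq_zero_of_length_eq {w : List (Fin r)} (hw : w.length = L + 1) :
    Lam.path K r L w = 0 := by
  have h : Lam.path K r L w =
      RingQuot.mkAlgHom K (pathRel K r L) ((w.map (FreeAlgebra.ι K)).prod) := by
    rw [map_list_prod, List.map_map]
    rfl
  rw [h]
  refine (RingQuot.mkAlgHom_rel K (s := pathRel K r L) ⟨w, hw, rfl, rfl⟩).trans ?_
  exact map_zero _

theorem Lam.path_eq_zero {w : List (Fin r)} (hw : L + 1 ≤ w.length) :
    Lam.path K r L w = 0 := by
  rw [← List.take_append_drop (L + 1) w, Lam.path_append,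
    Lam.path_eq_zero_of_length_eq K r L (by simp [hw]), zero_mul]

/-- The subspace of `Λ` spanned by the paths of length at least `n`. -/
def Lam.pathSpan (n : ℕ) : Submodule K (Lam K r L) :=
  Submodule.span K (Lam.path K r L '' {w | n ≤ w.length})

variable {K r L}

theorem Lam.path_mem_pathSpan {n : ℕ} {w : List (Fin r)} (hw : n ≤ w.length) :
    Lam.path K r L w ∈ Lam.pathSpan K r L n :=
  Submodule.subset_span ⟨w, hw, rfl⟩

theorem Lam.mul_mem_pathSpan {m n : ℕ} {a b : Lam K r L} (ha : a ∈ Lam.pathSpan K r L m)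
    (hb : b ∈ Lam.pathSpan K r L n) : a * b ∈ Lam.pathSpan K r L (m + n) := by
  have h : Lam.pathSpan K r L m * Lam.pathSpan K r L n ≤ Lam.pathSpan K r L (m + n) := by
    unfold Lam.pathSpan
    rw [Submodule.span_mul_span, Submodule.span_le]
    rintro _ ⟨_, ⟨v, hv, rfl⟩, _, ⟨w, hw, rfl⟩, rfl⟩
    refine Submodule.subset_span ⟨v ++ w, ?_, Lam.path_append K r L v w⟩
    simp only [Set.mem_ofPred_eq, List.length_append] at *
    omega
  exact h (Submodule.mul_mem_mul ha hb)

variable (K r L) in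
/-- The quotient map from the path algebra to `Λ`. -/
def Lam.mk : FreeAlgebra K (Fin r) →ₐ[K] Lam K r L := RingQuot.mkAlgHom K (pathRel K r L)

theorem Lam.mk_surjective : Function.Surjective (Lam.mk K r L) :=
  RingQuot.mkAlgHom_surjective K (pathRel K r L)

theorem Lam.mk_ι (i : Fin r) : Lam.mk K r L (FreeAlgebra.ι K i) = Lam.arrow K r L i := rfl

theorem Lam.mem_pathSpan_zero (a : Lam K r L) : a ∈ Lam.pathSpan K r L 0 := by
  obtain ⟨f, rfl⟩ := Lam.mk_surjective a
  induction f using FreeAlgebra.induction with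
  | grade0 c =>
    rw [AlgHom.commutes, Algebra.algebraMap_eq_smul_one, ← Lam.path_nil]
    exact Submodule.smul_mem _ _ (Lam.path_mem_pathSpan (Nat.zero_le _))
  | grade1 i =>
    rw [Lam.mk_ι, ← Lam.path_singleton]
    exact Lam.path_mem_pathSpan (Nat.zero_le _)
  | mul a b ha hb =>
    rw [map_mul]
    exact Lam.mul_mem_pathSpan (m := 0) (n := 0) ha hb
  | add a b ha hb =>
    rw [map_add]
    exact Submodule.add_mem _ ha hb

theorem Lam.eq_zero_of_mem_pathSpan {a : Lam K r L} (ha : a ∈ Lam.pathSpan K r L (L + 1)) :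
    a = 0 := by
  have h : Lam.pathSpan K r L (L + 1) = ⊥ := by
    rw [Lam.pathSpan, Submodule.span_eq_bot]
    rintro _ ⟨w, hw, rfl⟩
    exact Lam.path_eq_zero K r L hw
  rwa [h] at ha

theorem Lam.isNilpotent_of_mem_pathSpan {a : Lam K r L} (ha : a ∈ Lam.pathSpan K r L 1) :
    IsNilpotent a := by
  have h : ∀ n, a ^ n ∈ Lam.pathSpan K r L n := by
    intro n
    induction n with
    | zero => exact Lam.mem_pathSpan_zero _
    | succ n ih =>
      rw [pow_succ]
      exact Lam.mul_mem_pathSpan ih ha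
  exact ⟨L + 1, Lam.eq_zero_of_mem_pathSpan (h _)⟩

theorem Lam.exists_smul_one_add (a : Lam K r L) :
    ∃ c : K, ∃ b ∈ Lam.pathSpan K r L 1, a = c • 1 + b := by
  have ha := Lam.mem_pathSpan_zero a
  induction ha using Submodule.span_induction with
  | mem a ha =>
    obtain ⟨w, -, rfl⟩ := ha
    cases w with
    | nil => exact ⟨1, 0, Submodule.zero_mem _, by simp [Lam.path_nil]⟩
    | cons i w => exact ⟨0, _, Lam.path_mem_pathSpan (w := i :: w) (by simp), by simp⟩
  | zero => exact ⟨0, 0, Submodule.zero_mem _, by simp⟩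
  | add a a' _ _ h h' =>
    obtain ⟨c, b, hb, rfl⟩ := h
    obtain ⟨c', b', hb', rfl⟩ := h'
    exact ⟨c + c', b + b', Submodule.add_mem _ hb hb', by rw [add_smul]; abel⟩
  | smul k a _ h =>
    obtain ⟨c, b, hb, rfl⟩ := h
    exact ⟨k * c, k • b, Submodule.smul_mem _ _ hb, by rw [smul_add, mul_smul]⟩

/-- A maximal left ideal missing the arrow would contain some 1 - a * arrow. This is a unit, because
a * arrow is a combination of paths of positive length and so nilpotent. -/
theorem Lam.arrow_mem_jacobson (i : Fin r) :
    Lam.arrow K r L i ∈ Ring.jacobson (Lam K r L) := by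
  rw [Ring.jacobson_eq_sInf_isMaximal, Submodule.mem_sInf]
  intro m hm
  by_contra hi
  have htop := Ideal.IsMaximal.out (self := hm) |>.2 (m ⊔ Ideal.span {Lam.arrow K r L i}) (by
    rw [left_lt_sup, Ideal.span_singleton_le_iff_mem]
    exact hi)
  have h1 : (1 : Lam K r L) ∈ m ⊔ Ideal.span {Lam.arrow K r L i} := htop ▸ Submodule.mem_top
  obtain ⟨x, hx, y, hy, hxy⟩ := Submodule.mem_sup.mp h1
  obtain ⟨a, rfl⟩ := Ideal.mem_span_singleton'.mp hy
  have hnil : IsNilpotent (a * Lam.arrow K r L i) := by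
    apply Lam.isNilpotent_of_mem_pathSpan
    rw [← Lam.path_singleton]
    exact Lam.mul_mem_pathSpan (m := 0) (n := 1) (Lam.mem_pathSpan_zero a)
      (Lam.path_mem_pathSpan (by simp))
  have hu : IsUnit x := by
    rw [eq_sub_of_add_eq hxy]
    exact hnil.isUnit_one_sub
  exact hm.ne_top (Ideal.eq_top_of_isUnit_mem m hx hu)

/-- Every element is a scalar plus a nilpotent combination of positive paths. A nonzero scalar would
make it a unit, which the radical cannot contain. -/
theorem Lam.mem_pathSpan_of_mem_jacobson {a : Lam K r L}
    (ha : a ∈ Ring.jacobson (Lam K r L)) : a ∈ Lam.pathSpan K r L 1 := by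
  rcases subsingleton_or_nontrivial (Lam K r L) with _ | _
  · rw [Subsingleton.elim a 0]
    exact Submodule.zero_mem _
  obtain ⟨c, b, hb, rfl⟩ := Lam.exists_smul_one_add a
  by_cases hc : c = 0
  · simpa [hc] using hb
  exfalso
  have hu : IsUnit (c • (1 : Lam K r L) + b) := by
    have hcu : IsUnit (c • (1 : Lam K r L)) := by
      rw [← Algebra.algebraMap_eq_smul_one]
      exact (IsUnit.mk0 c hc).map _
    refine (Lam.isNilpotent_of_mem_pathSpan hb).isUnit_add_left_of_commute hcu ?_
    exact ((Commute.one_left b).smul_left c).symm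
  exact (Ring.jacobson_lt_top (Lam K r L)).ne (Ideal.eq_top_of_isUnit_mem _ ha hu)

theorem Lam.mem_pathSpan_of_mem_jacobson_pow {n : ℕ} {a : Lam K r L}
    (ha : a ∈ (Ring.jacobson (Lam K r L) ^ n : Ideal (Lam K r L))) :
    a ∈ Lam.pathSpan K r L n := by
  induction n generalizing a with
  | zero => exact Lam.mem_pathSpan_zero a
  | succ n ih =>
    rw [Submodule.pow_succ] at ha
    induction ha using Submodule.smul_induction_on' with
    | smul x hx y hy => exact Lam.mul_mem_pathSpan (ih hx) (Lam.mem_pathSpan_of_mem_jacobson hy)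
    | add x _ y _ hx hy => exact Submodule.add_mem _ hx hy

theorem Lam.jacobson_pow_eq_bot :
    (Ring.jacobson (Lam K r L) ^ (L + 1) : Ideal (Lam K r L)) = ⊥ :=
  le_bot_iff.mp fun _ ha =>
    Lam.eq_zero_of_mem_pathSpan (Lam.mem_pathSpan_of_mem_jacobson_pow ha)

theorem Lam.path_mem_jacobson_pow (w : List (Fin r)) :
    Lam.path K r L w ∈ (Ring.jacobson (Lam K r L) ^ w.length : Ideal (Lam K r L)) := by
  induction w using List.reverseRecOn with
  | nil => simp [Submodule.pow_zero]
  | append_singleton w i ih =>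
    rw [Lam.path_append, Lam.path_singleton, List.length_append, List.length_singleton,
      Submodule.pow_succ]
    exact Submodule.smul_mem_smul ih (Lam.arrow_mem_jacobson i)

theorem RepVar.path_smul {d : ℕ} (x : RepVar K r L d) (w : List (Fin r)) (m : x.Mod) :
    Lam.path K r L w • m = ((w.map x.mat).prod).mulVec m := by
  induction w with
  | nil =>
    rw [Lam.path_nil, one_smul, List.map_nil, List.prod_nil]
    exact (Matrix.one_mulVec (m : Fin d → K)).symm
  | cons i w ih =>
    rw [Lam.path_cons, mul_smul, RepVar.arrow_smul, ih, List.map_cons, List.prod_cons]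
    exact Matrix.mulVec_mulVec (m : Fin d → K) _ _

noncomputable instance {d : ℕ} (x : RepVar K r L d) : Module K x.Mod :=
  inferInstanceAs (Module K (Fin d → K))

instance {d : ℕ} (x : RepVar K r L d) : Module.Finite K x.Mod :=
  inferInstanceAs (Module.Finite K (Fin d → K))

instance {d : ℕ} (x : RepVar K r L d) : IsScalarTower K (Lam K r L) x.Mod where
  smul_assoc k a m := by
    change (x.toAlgHom (k • a)).mulVec m = k • (x.toAlgHom a).mulVec m
    rw [map_smul]
    exact Matrix.smul_mulVec k _ (m : Fin d → K)

instance {d : ℕ} (x : RepVar K r L d) : IsNoetherian (Lam K r L) x.Mod :=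
  isNoetherian_of_tower K inferInstance

instance {d : ℕ} (x : RepVar K r L d) : IsArtinian (Lam K r L) x.Mod :=
  isArtinian_of_tower K inferInstance

end Algebra

/-! ### Direct summands, Loewy length and decompositions. -/

section Modules

variable {R M : Type*} [Ring R] [AddCommGroup M] [Module R M]

/-- Nakayama gives n in N outside JN. The projection along N' carries JM into JN, so n is outside JM
too and `hM` applies to it. -/
theorem loewyLength_eq_of_isCompl [IsNoetherian R M] {L : ℕ}
    (hJ : (Ring.jacobson R ^ (L + 1) : Ideal R) = ⊥)
    (hM : ∀ m : M, m ∉ Ring.jacobson R • (⊤ : Submodule R M) →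
      ∃ a ∈ (Ring.jacobson R ^ L : Ideal R), a • m ≠ 0)
    {N N' : Submodule R M} (hN : IsCompl N N') (hne : Nontrivial N) :
    loewyLength R N = L + 1 := by
  have hlt : Ring.jacobson R • (⊤ : Submodule R N) < ⊤ := Submodule.jacobson_smul_lt_top _
  obtain ⟨n, -, hn⟩ := SetLike.exists_of_lt hlt
  have hnM : (n : M) ∉ Ring.jacobson R • (⊤ : Submodule R M) := by
    intro h
    apply hn
    have h' := Submodule.mem_map_of_mem (f := N.projectionOnto N' hN) h
    rw [Submodule.map_smul''] at h'
    have h2 := smul_mono_right (Ring.jacobson R)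
      (le_top (a := Submodule.map (N.projectionOnto N' hN) ⊤)) h'
    simpa using h2
  obtain ⟨a, ha, han⟩ := hM _ hnM
  refine le_antisymm (Nat.sInf_le ?_) (le_csInf ⟨L + 1, ?_⟩ ?_)
  · simp [hJ]
  · simp [hJ]
  · intro k hk
    by_contra! hkL
    have h1 : a • n ∈ (Ring.jacobson R ^ k : Ideal R) • (⊤ : Submodule R N) :=
      Submodule.smul_mem_smul (Ideal.pow_le_pow_right (by omega) ha) Submodule.mem_top
    rw [Set.mem_ofPred_eq.mp hk, Submodule.mem_bot] at h1
    exact han (by simpa using congrArg Subtype.val h1)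

theorem exists_supIndep_indecomposable [IsArtinian R M] (N : Submodule R M) :
    ∃ S : Finset (Submodule R M), S.SupIndep id ∧ S.sup id = N ∧
      ∀ A ∈ S, Indecomposable R A := by
  classical
  induction N using IsWellFounded.induction (· < · : Submodule R M → Submodule R M → Prop) with
  | ind N ih =>
    by_cases h0 : N = ⊥
    · exact ⟨∅, by simp, by simp [h0], by simp⟩
    by_cases hind : Indecomposable R N
    · exact ⟨{N}, by simp, by simp, by simpa using hind⟩
    have hnt : Nontrivial N := Submodule.nontrivial_iff_ne_bot.mpr h0
    simp only [Indecomposable, hnt, true_and, not_forall, not_or] at hind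
    obtain ⟨A, B, hAB, hA, hB⟩ := hind
    have hlt : ∀ {A B : Submodule R N}, IsCompl A B → B ≠ ⊥ → A.map N.subtype < N := by
      intro A B hAB hB
      refine lt_of_le_of_ne (Submodule.map_subtype_le N A) fun h => hB ?_
      have hAt : A = ⊤ := by
        apply Submodule.map_injective_of_injective N.injective_subtype
        rw [h, Submodule.map_subtype_top]
      rw [hAt] at hAB
      exact by simpa using hAB.inf_eq_bot
    obtain ⟨S, hS, hSA, hSi⟩ := ih _ (hlt hAB hB)
    obtain ⟨T, hT, hTB, hTi⟩ := ih _ (hlt hAB.symm hA)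
    refine ⟨S ∪ T, hS.union hT ?_, ?_, ?_⟩
    · rw [hSA, hTB]
      exact Submodule.disjoint_map N.injective_subtype hAB.disjoint
    · rw [Finset.sup_union, hSA, hTB, ← Submodule.map_sup, hAB.sup_eq_top, Submodule.map_subtype_top]
    · intro C hC
      rcases Finset.mem_union.mp hC with h | h
      exacts [hSi C h, hTi C h]

theorem exists_isInternal_indecomposable [IsArtinian R M] :
    ∃ (n : ℕ) (N : Fin n → Submodule R M), DirectSum.IsInternal N ∧
      ∀ i, Indecomposable R (N i) := by
  obtain ⟨S, hS, hST, hSi⟩ := exists_supIndep_indecomposable (⊤ : Submodule R M)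
  refine ⟨S.card, fun i => (S.equivFin.symm i : Submodule R M), ?_, fun i => hSi _ (Subtype.mem _)⟩
  rw [DirectSum.isInternal_submodule_iff_iSupIndep_and_iSup_eq_top]
  constructor
  · have h : iSupIndep (fun A : S => (A : Submodule R M)) :=
      iSupIndep_comp_coe_iff_supIndep.mpr hS
    exact h.comp S.equivFin.symm.injective
  · rw [S.equivFin.symm.iSup_comp (g := fun A : S => (A : Submodule R M)), ← hST,
      Finset.sup_eq_iSup, iSup_subtype]
    simp

end Modules
-- Zariski topology, regular functions and open rank conditions.
section Zariski

theorem isClosed_zariskiTopology_iff {K σ : Type*} [Field K] {C : Set (σ → K)} :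
    @IsClosed _ (zariskiTopology K σ) C ↔
      ∃ I : Ideal (MvPolynomial σ K), C = MvPolynomial.zeroLocus K I := by
  rw [← @isOpen_compl_iff _ _ (zariskiTopology K σ)]
  change Cᶜᶜ ∈ {V | ∃ I : Ideal (MvPolynomial σ K), V = MvPolynomial.zeroLocus K I} ↔ _
  rw [compl_compl, Set.mem_ofPred_eq]

theorem noetherianSpace_zariskiTopology (K σ : Type*) [Field K] [Finite σ] :
    @TopologicalSpace.NoetherianSpace (σ → K) (zariskiTopology K σ) := by
  let _ := zariskiTopology K σ
  have hclosed : ∀ C : TopologicalSpace.Closeds (σ → K),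
      MvPolynomial.zeroLocus K (MvPolynomial.vanishingIdeal K (C : Set (σ → K))) = C := by
    intro C
    obtain ⟨I, hI⟩ := isClosed_zariskiTopology_iff.mp C.isClosed
    rw [hI]
    exact MvPolynomial.zeroLocus_vanishingIdeal_galoisConnection.l_u_l_eq_l I
  have hanti : StrictAnti fun C : TopologicalSpace.Closeds (σ → K) =>
      MvPolynomial.vanishingIdeal K (C : Set (σ → K)) := by
    intro C D hCD
    refine lt_of_le_of_ne (MvPolynomial.vanishingIdeal_anti_mono hCD.le) fun h => ?_
    apply hCD.ne
    apply SetLike.coe_injective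
    rw [← hclosed C, ← hclosed D]
    exact congrArg _ h.symm
  refine ((TopologicalSpace.noetherianSpace_TFAE (σ → K)).out 0 1).mpr ?_
  exact hanti.wellFoundedLT

variable {K : Type*} [Field K] {r L d : ℕ}

instance : TopologicalSpace.NoetherianSpace (RepVar K r L d) :=
  letI := zariskiTopology K (Fin r × Fin d × Fin d)
  haveI := noetherianSpace_zariskiTopology K (Fin r × Fin d × Fin d)
  Topology.IsInducing.noetherianSpace (i := RepVar.coords) ⟨rfl⟩

variable (K r L d) in
/-- The algebra of regular functions on `Rep_d(Λ)`. -/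
noncomputable def RepVar.regular : Subalgebra K (RepVar K r L d → K) :=
  (MvPolynomial.aeval (fun p (x : RepVar K r L d) => x.coords p)).range

theorem RepVar.aeval_apply (p : MvPolynomial (Fin r × Fin d × Fin d) K) (x : RepVar K r L d) :
    MvPolynomial.aeval (fun p (x : RepVar K r L d) => x.coords p) p x =
      MvPolynomial.aeval x.coords p :=
  DFunLike.congr_fun (MvPolynomial.comp_aeval (fun p (x : RepVar K r L d) => x.coords p)
    (Pi.evalAlgHom K (fun _ : RepVar K r L d => K) x)) p

theorem RepVar.isOpen_ne_zero {f : RepVar K r L d → K} (hf : f ∈ RepVar.regular K r L d) :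
    IsOpen {x | f x ≠ 0} := by
  let _ := zariskiTopology K (Fin r × Fin d × Fin d)
  obtain ⟨p, rfl⟩ := hf
  refine ⟨(MvPolynomial.zeroLocus K (Ideal.span {p}))ᶜ, ?_, ?_⟩
  · rw [isOpen_compl_iff, isClosed_zariskiTopology_iff]
    exact ⟨_, rfl⟩
  · ext x
    simp [MvPolynomial.zeroLocus_span, RepVar.aeval_apply]

theorem RepVar.exists_regular_of_mem_open {U : Set (RepVar K r L d)} (hU : IsOpen U)
    {x : RepVar K r L d} (hx : x ∈ U) :
    ∃ f ∈ RepVar.regular K r L d, f x ≠ 0 ∧ ∀ y, f y ≠ 0 → y ∈ U := by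
  let _ := zariskiTopology K (Fin r × Fin d × Fin d)
  obtain ⟨V, hV, rfl⟩ := hU
  obtain ⟨I, hI⟩ := isClosed_zariskiTopology_iff.mp hV.isClosed_compl
  have hmem : ∀ z, z ∈ V ↔ ¬ ∀ p ∈ I, MvPolynomial.aeval z p = 0 := by
    intro z
    rw [← MvPolynomial.mem_zeroLocus_iff, ← hI, Set.mem_compl_iff, not_not]
  have hx' := (hmem _).mp hx
  push Not at hx'
  obtain ⟨p, hp, hpx⟩ := hx'
  refine ⟨_, ⟨p, rfl⟩, ?_, fun y hy => (hmem _).mpr fun h => hy ?_⟩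
  · exact (RepVar.aeval_apply p x).trans_ne hpx
  · exact (RepVar.aeval_apply p y).trans (h p hp)

theorem RepVar.coord_mem_regular (i : Fin r) (a b : Fin d) :
    (fun x : RepVar K r L d => x.mat i a b) ∈ RepVar.regular K r L d :=
  ⟨MvPolynomial.X (i, a, b), by simp [RepVar.coords]⟩

theorem RepVar.mul_apply_mem_regular {ι κ μ : Type*} [Fintype κ]
    {A : RepVar K r L d → Matrix ι κ K} {B : RepVar K r L d → Matrix κ μ K}
    (hA : ∀ i j, (fun x => A x i j) ∈ RepVar.regular K r L d)
    (hB : ∀ i j, (fun x => B x i j) ∈ RepVar.regular K r L d) (i : ι) (j : μ) :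
    (fun x => (A x * B x) i j) ∈ RepVar.regular K r L d := by
  have h : (fun x => (A x * B x) i j) = ∑ k, (fun x => A x i k) * (fun x => B x k j) := by
    ext x
    simp [Matrix.mul_apply]
  rw [h]
  exact Subalgebra.sum_mem _ fun k _ => Subalgebra.mul_mem _ (hA i k) (hB k j)

theorem RepVar.const_mem_regular (c : K) :
    (fun _ : RepVar K r L d => c) ∈ RepVar.regular K r L d :=
  Subalgebra.algebraMap_mem _ c

theorem RepVar.prod_apply_mem_regular (w : List (Fin r)) (a b : Fin d) :
    (fun x : RepVar K r L d => (w.map x.mat).prod a b) ∈ RepVar.regular K r L d := by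
  induction w generalizing a b with
  | nil => exact RepVar.const_mem_regular _
  | cons i w ih =>
    simp only [List.map_cons, List.prod_cons]
    exact RepVar.mul_apply_mem_regular (fun a b => RepVar.coord_mem_regular i a b) ih a b

theorem RepVar.det_mem_regular {n : Type*} [Fintype n] [DecidableEq n]
    {A : RepVar K r L d → Matrix n n K}
    (hA : ∀ i j, (fun x => A x i j) ∈ RepVar.regular K r L d) :
    (fun x => (A x).det) ∈ RepVar.regular K r L d := by
  have h : (fun x => (A x).det) =
      ∑ σ : Equiv.Perm n, ((Equiv.Perm.sign σ : ℤ) : K) • ∏ i, (fun x => A x (σ i) i) := by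
    ext x
    simp [Matrix.det_apply']
  rw [h]
  exact Subalgebra.sum_mem _ fun σ _ => Subalgebra.smul_mem _
    (Subalgebra.prod_mem _ fun i _ => hA _ _) _

/-- A certificate for a rank bound: with P and Q fixed, nonvanishing of det (P * A * Q) is an open
condition on A that still forces the bound. It takes the place of minors. -/
theorem exists_mul_mul_eq_one_of_le_rank {ι κ : Type*} [Fintype ι] [Fintype κ] [DecidableEq ι]
    [DecidableEq κ] {A : Matrix ι κ K} {n : ℕ} (h : n ≤ A.rank) :
    ∃ (P : Matrix (Fin n) ι K) (Q : Matrix κ (Fin n) K), P * A * Q = 1 := by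
  obtain ⟨v, hv⟩ := exists_linearIndependent_of_le_finrank (R := K)
    (M := LinearMap.range A.mulVecLin) h
  choose q hq using fun i => (v i).2
  let Q : Matrix κ (Fin n) K := Matrix.of fun k i => q i k
  have hcol : (A * Q).col = fun i => (v i : ι → K) := by
    ext i a
    rw [← hq i]
    rfl
  have hinj : Function.Injective (A * Q).mulVec := by
    rw [Matrix.mulVec_injective_iff, hcol]
    exact hv.map' _ (Submodule.ker_subtype _)
  obtain ⟨g, hg⟩ := LinearMap.exists_leftInverse_of_injective (A * Q).mulVecLin
    (LinearMap.ker_eq_bot.mpr hinj)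
  refine ⟨LinearMap.toMatrix' g, Q, ?_⟩
  rw [Matrix.mul_assoc, ← LinearMap.toMatrix'_toLin' (A * Q), ← LinearMap.toMatrix'_comp,
    Matrix.toLin'_apply', hg,
    LinearMap.toMatrix'_id]

theorem RepVar.isOpen_le_rank {ι κ : Type*} [Fintype ι] [Fintype κ]
    {A : RepVar K r L d → Matrix ι κ K}
    (hA : ∀ i j, (fun x => A x i j) ∈ RepVar.regular K r L d) (n : ℕ) :
    IsOpen {x | n ≤ (A x).rank} := by
  classical
  rw [isOpen_iff_forall_mem_open]
  intro x hx
  obtain ⟨P, Q, h⟩ := exists_mul_mul_eq_one_of_le_rank hx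
  refine ⟨{y | (P * A y * Q).det ≠ 0}, fun y hy => ?_, RepVar.isOpen_ne_zero ?_, ?_⟩
  · have h1 : (P * A y * Q).rank = n := by
      rw [Matrix.rank_of_isUnit _ ((Matrix.isUnit_iff_isUnit_det _).mpr hy.isUnit), Fintype.card_fin]
    calc n = (P * A y * Q).rank := h1.symm
      _ ≤ (P * A y).rank := Matrix.rank_mul_le_left _ _
      _ ≤ (A y).rank := Matrix.rank_mul_le_right _ _
  · exact RepVar.det_mem_regular (RepVar.mul_apply_mem_regular
      (RepVar.mul_apply_mem_regular (fun _ _ => RepVar.const_mem_regular _) hA)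
      fun _ _ => RepVar.const_mem_regular _)
  · simp [h]

/-- Regular functions restrict to one-variable polynomials on a line, and a product of two nonzero
polynomials has a nonroot in an infinite field. -/
theorem RepVar.exists_mem_inter_of_line [Infinite K] (x : K → RepVar K r L d)
    (A B : Fin r → Matrix (Fin d) (Fin d) K) (hx : ∀ t i, (x t).mat i = A i + t • B i)
    {U V : Set (RepVar K r L d)} (hU : IsOpen U) (hV : IsOpen V) {s t : K} (hs : x s ∈ U)
    (ht : x t ∈ V) : ∃ u, x u ∈ U ∩ V := by
  have key : ∀ f ∈ RepVar.regular K r L d, ∃ p : Polynomial K, ∀ t, p.eval t = f (x t) := by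
    rintro _ ⟨p, rfl⟩
    refine ⟨MvPolynomial.aeval (fun q : Fin r × Fin d × Fin d =>
      Polynomial.C (A q.1 q.2.1 q.2.2) + Polynomial.X * Polynomial.C (B q.1 q.2.1 q.2.2)) p,
      fun t => ?_⟩
    refine Eq.trans ?_ (RepVar.aeval_apply p (x t)).symm
    rw [← Polynomial.coe_aeval_eq_eval, ← AlgHom.comp_apply, MvPolynomial.comp_aeval]
    congr 2
    ext q
    simp [RepVar.coords, hx, mul_comm t]
  obtain ⟨f, hf, hfs, hfU⟩ := RepVar.exists_regular_of_mem_open hU hs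
  obtain ⟨g, hg, hgt, hgV⟩ := RepVar.exists_regular_of_mem_open hV ht
  obtain ⟨p, hp⟩ := key f hf
  obtain ⟨q, hq⟩ := key g hg
  have hpq : p * q ≠ 0 := by
    refine mul_ne_zero ?_ ?_
    · rintro rfl
      exact hfs (by simpa using (hp s).symm)
    · rintro rfl
      exact hgt (by simpa using (hq t).symm)
  obtain ⟨u, hu⟩ : ∃ u, (p * q).eval u ≠ 0 := by
    by_contra! h
    exact hpq (Polynomial.funext fun u => by simpa using h u)
  rw [Polynomial.eval_mul, hp, hq] at hu
  exact ⟨u, hfU _ (left_ne_zero_of_mul hu), hgV _ (right_ne_zero_of_mul hu)⟩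

end Zariski
-- Jointly injective and surjective tuples; coordinates on a subquotient.
section LinearAlgebra

variable {K : Type*} [Field K]

/-- Fill r blocks of size b one after the other. As b ≤ a, the block of index 0 is completely
filled, and `s` lists it. -/
theorem exists_injective_prod_of_le_mul {r a b : ℕ} (hr : 0 < r) (hba : b ≤ a) (hab : a ≤ r * b) :
    ∃ (e : Fin a → Fin r × Fin b) (s : Fin b → Fin a) (i : Fin r),
      Function.Injective e ∧ ∀ q, e (s q) = (i, q) := by
  refine ⟨fun p => finProdFinEquiv.symm (Fin.castLE hab p), Fin.castLE hba, ⟨0, hr⟩,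
    finProdFinEquiv.symm.injective.comp (Fin.castLE_injective hab), fun q => ?_⟩
  rw [Equiv.symm_apply_eq]
  ext
  simp [finProdFinEquiv]

theorem exists_linearMaps_jointly_injective_surjective {r a b : ℕ} (hr : 0 < r) (hab : a ≤ r * b)
    (hba : b ≤ r * a) :
    ∃ A : Fin r → (Fin a → K) →ₗ[K] (Fin b → K),
      (∀ u, ∃ v : Fin r → Fin a → K, ∑ i, A i (v i) = u) ∧
      ∀ v, (∀ i, A i v = 0) → v = 0 := by
  rcases le_total a b with h | h
  · obtain ⟨e, s, i₀, he, hs⟩ := exists_injective_prod_of_le_mul hr h hba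
    -- Each target coordinate copies one source coordinate through one operator. Injectivity of `e`
    -- makes these choices independent, giving surjectivity; the filled block `i₀` sees all source
    -- coordinates.
    let A : Fin r → (Fin a → K) →ₗ[K] (Fin b → K) := fun i =>
      LinearMap.pi fun q => if (e q).1 = i then LinearMap.proj (e q).2 else 0
    have hA : ∀ i v q, A i v q = if (e q).1 = i then v (e q).2 else 0 := by
      intro i v q
      simp only [A, LinearMap.pi_apply]
      split_ifs <;> simp
    refine ⟨A, fun u => ⟨fun i p => Function.extend e u 0 (i, p), ?_⟩, fun v hv => ?_⟩
    · ext q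
      simp [hA, he.extend_apply]
    · ext p
      have := congrFun (hv i₀) (s p)
      simpa [hA, hs] using this
  · obtain ⟨e, s, i₀, he, hs⟩ := exists_injective_prod_of_le_mul hr h hab
    have hsi : Function.Injective s := fun p q hpq => by
      simpa [hs] using congrArg (fun t => (e t).2) hpq
    -- The transposed pattern: the basis vector p goes to the basis vector `(e p).2` under the
    -- operator `(e p).1` and to 0 under the others.
    let A : Fin r → (Fin a → K) →ₗ[K] (Fin b → K) := fun i =>
      LinearMap.funLeft K K (fun q => (i, q)) ∘ₗ Function.ExtendByZero.linearMap K e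
    have hA : ∀ i v q, A i v q = Function.extend e v 0 (i, q) := fun _ _ _ => rfl
    refine ⟨A, fun u => ⟨Pi.single i₀ (Function.extend s u 0), ?_⟩, fun v hv => ?_⟩
    · rw [Finset.sum_eq_single i₀ (fun i _ hi => by rw [Pi.single_eq_of_ne hi, map_zero])
        (by simp)]
      ext q
      rw [hA, Pi.single_eq_same, ← hs, he.extend_apply, hsi.extend_apply]
    · ext p
      have := congrFun (hv (e p).1) (e p).2
      rw [hA] at this
      exact (he.extend_apply v 0 p).symm.trans this

variable {V : Type*} [AddCommGroup V] [Module K V] [Module.Finite K V]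

/-- Coordinates on F/F', extended to all of V and split by a section into F, so that operators on V
can be assembled from maps between layers without quotient spaces. -/
theorem exists_coordinates_of_le {F F' : Submodule K V} (h : F' ≤ F) :
    ∃ (c : ℕ) (π : V →ₗ[K] (Fin c → K)) (σ : (Fin c → K) →ₗ[K] V),
      c + Module.finrank K F' = Module.finrank K F ∧ (∀ u, π (σ u) = u) ∧ (∀ u, σ u ∈ F) ∧
        (∀ x ∈ F', π x = 0) ∧
      ∀ x ∈ F, π x = 0 → x ∈ F' := by
  obtain ⟨H, hH⟩ := F'.exists_isCompl
  have hdisj : Disjoint (F ⊓ H) F' := hH.symm.disjoint.mono_left inf_le_right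
  have hsup : (F ⊓ H) ⊔ F' = F := by
    rw [inf_sup_assoc_of_le H h, hH.symm.sup_eq_top, inf_top_eq]
  have hdim := Submodule.finrank_sup_add_finrank_inf_eq (F ⊓ H) F'
  rw [hsup, hdisj.eq_bot, finrank_bot, add_zero] at hdim
  let e : (Fin (Module.finrank K ↥(F ⊓ H)) → K) ≃ₗ[K] ↥(F ⊓ H) :=
    LinearEquiv.ofFinrankEq _ _ (Module.finrank_fin_fun K)
  let σ := (F ⊓ H).subtype ∘ₗ e.toLinearMap
  have hinj : LinearMap.ker (F'.mkQ ∘ₗ σ) = ⊥ := by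
    rw [LinearMap.ker_eq_bot']
    intro u hu
    have h1 : σ u ∈ F' := by simpa using hu
    have h2 := Submodule.disjoint_def.mp hdisj _ (e u).2 h1
    exact e.map_eq_zero_iff.mp (Subtype.ext h2)
  obtain ⟨p, hp⟩ := LinearMap.exists_leftInverse_of_injective _ hinj
  have hpσ : ∀ u, p (F'.mkQ (σ u)) = u := fun u => LinearMap.congr_fun hp u
  have hker : ∀ x ∈ F', p (F'.mkQ x) = 0 := fun x hx => by
    rw [(Submodule.Quotient.mk_eq_zero F').mpr hx |> fun h => (h : F'.mkQ x = 0), map_zero]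
  refine ⟨_, p ∘ₗ F'.mkQ, σ, hdim.symm, hpσ, fun u => (e u).2.1, hker, fun x hx hx0 => ?_⟩
  rw [← hsup] at hx
  obtain ⟨g, hg, f, hf, rfl⟩ := Submodule.mem_sup.mp hx
  have hgσ : σ (e.symm ⟨g, hg⟩) = g := by simp [σ]
  have h0 : e.symm ⟨g, hg⟩ = 0 := by
    have := hpσ (e.symm ⟨g, hg⟩)
    rw [hgσ] at this
    rw [← this]
    simpa only [LinearMap.comp_apply, map_add, hker f hf, add_zero] using hx0
  rw [h0, map_zero] at hgσ
  simpa [← hgσ] using hf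

end LinearAlgebra

/-! ### Shifted filtrations and the dimensions of their layers. -/

section Filtrations

variable {K : Type*} [Field K] {V : Type*} [AddCommGroup V] [Module K V] {r : ℕ}

/-- A filtration of `V` of length `L + 1` which every operator of the tuple `T` shifts by one. -/
structure IsShiftedBy (T : Fin r → Module.End K V) (L : ℕ) (F : ℕ → Submodule K V) : Prop where
  zero : F 0 = ⊤
  last : F (L + 1) = ⊥
  anti : Antitone F
  shift : ∀ k i, ∀ x ∈ F k, T i x ∈ F (k + 1)

theorem IsShiftedBy.add_smul {T T' : Fin r → Module.End K V} {L : ℕ} {F : ℕ → Submodule K V}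
    (h : IsShiftedBy T L F) (h' : IsShiftedBy T' L F) (t : K) :
    IsShiftedBy (fun i => T i + t • (T' i - T i)) L F where
  zero := h.zero
  last := h.last
  anti := h.anti
  shift k i x hx := Submodule.add_mem _ (h.shift k i x hx)
    (Submodule.smul_mem _ _ (Submodule.sub_mem _ (h'.shift k i x hx) (h.shift k i x hx)))

theorem IsShiftedBy.prod_mem {T : Fin r → Module.End K V} {L : ℕ} {F : ℕ → Submodule K V}
    (h : IsShiftedBy T L F) (w : List (Fin r)) {k : ℕ} {x : V} (hx : x ∈ F k) :
    (w.map T).prod x ∈ F (k + w.length) := by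
  induction w with
  | nil => simpa using hx
  | cons i w ih => simpa [← add_assoc] using h.shift _ i _ ih

theorem IsShiftedBy.prod_eq_zero {T : Fin r → Module.End K V} {L : ℕ} {F : ℕ → Submodule K V}
    (h : IsShiftedBy T L F) {w : List (Fin r)} (hw : w.length = L + 1) : (w.map T).prod = 0 := by
  ext x
  have := h.prod_mem w (k := 0) (x := x) (h.zero ▸ Submodule.mem_top)
  simpa [hw, h.last] using this

/-- The radical filtration of a tuple of operators. -/
def radicalFiltration (T : Fin r → Module.End K V) : ℕ → Submodule K V
  | 0 => ⊤
  | k + 1 => ⨆ i, (radicalFiltration T k).map (T i)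

theorem radicalFiltration_succ_le (T : Fin r → Module.End K V) (k : ℕ) :
    radicalFiltration T (k + 1) ≤ radicalFiltration T k := by
  induction k with
  | zero => exact le_top
  | succ k ih => exact iSup_mono fun i => Submodule.map_mono ih

theorem radicalFiltration_le_span (T : Fin r → Module.End K V) (k : ℕ) :
    radicalFiltration T k ≤
      Submodule.span K {y | ∃ w : List (Fin r), w.length = k ∧ ∃ x, y = (w.map T).prod x} := by
  induction k with
  | zero => exact fun x _ => Submodule.subset_span ⟨[], rfl, x, by simp⟩
  | succ k ih =>
    refine iSup_le fun i => (Submodule.map_mono ih).trans ?_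
    rw [Submodule.map_span_le]
    rintro _ ⟨w, rfl, x, rfl⟩
    exact Submodule.subset_span ⟨i :: w, by simp, x, by simp⟩

theorem isShiftedBy_radicalFiltration {T : Fin r → Module.End K V} {L : ℕ}
    (hT : ∀ w : List (Fin r), w.length = L + 1 → (w.map T).prod = 0) :
    IsShiftedBy T L (radicalFiltration T) where
  zero := rfl
  last := by
    refine le_bot_iff.mp ((radicalFiltration_le_span T _).trans ?_)
    rw [Submodule.span_le]
    rintro _ ⟨w, hw, x, rfl⟩
    simp [hT w hw]
  anti := antitone_nat_of_succ_le (radicalFiltration_succ_le T)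
  shift k i x hx := (le_iSup (fun i => (radicalFiltration T k).map (T i)) i)
    (Submodule.mem_map_of_mem hx)

variable [Module.Finite K V]

open Module (finrank)

/-- The dimensions of the layers of a filtration grow at most by the factor `r`. -/
def GrowthBounded (r : ℕ) (F : ℕ → Submodule K V) : Prop :=
  ∀ k, finrank K (F (k + 1)) + r * finrank K (F (k + 1)) ≤
    r * finrank K (F k) + finrank K (F (k + 2))

/-- The dimensions of the first `L + 1` layers of a filtration decay at most by the factor `r`. -/
def DecayBounded (r L : ℕ) (F : ℕ → Submodule K V) : Prop :=
  ∀ k < L, finrank K (F k) + r * finrank K (F (k + 2)) ≤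
    finrank K (F (k + 1)) + r * finrank K (F (k + 1))

/-- The operators induce a surjection from r copies of each layer onto the next. -/
theorem growthBounded_radicalFiltration (T : Fin r → Module.End K V) :
    GrowthBounded r (radicalFiltration T) := by
  intro k
  obtain ⟨c, π, σ, hc, hπσ, hσ, hπ, hker⟩ := exists_coordinates_of_le (radicalFiltration_succ_le T k)
  let Φ : (Fin r → Fin c → K) →ₗ[K] V :=
    ∑ i, T i ∘ₗ σ ∘ₗ LinearMap.proj i
  have hΦ : radicalFiltration T (k + 1) ≤ LinearMap.range Φ ⊔ radicalFiltration T (k + 2) := by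
    refine iSup_le fun i => ?_
    rintro _ ⟨x, hx, rfl⟩
    have h1 : x - σ (π x) ∈ radicalFiltration T (k + 1) :=
      hker _ (Submodule.sub_mem _ hx (hσ _)) (by rw [map_sub, hπσ, sub_self])
    have h2 : T i x = T i (σ (π x)) + T i (x - σ (π x)) := by rw [← map_add, add_sub_cancel]
    rw [h2]
    refine Submodule.add_mem_sup ⟨Pi.single i (π x), ?_⟩ ?_
    · simp only [Φ, LinearMap.sum_apply, LinearMap.comp_apply, LinearMap.proj_apply]
      rw [Finset.sum_eq_single i (fun j _ hj => by rw [Pi.single_eq_of_ne hj, map_zero, map_zero])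
        (by simp), Pi.single_eq_same]
    · exact (le_iSup (fun i => (radicalFiltration T (k + 1)).map (T i)) i)
        (Submodule.mem_map_of_mem h1)
  have h1 := Submodule.finrank_mono hΦ
  have h2 := Submodule.finrank_add_le_finrank_add_finrank (LinearMap.range Φ)
    (radicalFiltration T (k + 2))
  have h3 := LinearMap.finrank_range_le Φ
  rw [Module.finrank_pi_fintype] at h3
  simp only [Module.finrank_fin_fun, Finset.sum_const, Finset.card_univ, Fintype.card_fin,
    smul_eq_mul] at h3
  have h4 : r * finrank K (radicalFiltration T k) =
      r * c + r * finrank K (radicalFiltration T (k + 1)) := by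
    rw [← mul_add, hc]
  omega

/-- If c_k > r c_(k+1), the map from F_k to r copies of the next layer has a kernel of dimension
greater than that of F_(k+1). -/
theorem IsShiftedBy.exists_mem_of_lt {T : Fin r → Module.End K V} {L : ℕ}
    {F : ℕ → Submodule K V} (h : IsShiftedBy T L F) {k : ℕ}
    (hk : finrank K (F (k + 1)) + r * finrank K (F (k + 1)) <
      finrank K (F k) + r * finrank K (F (k + 2))) :
    ∃ n ∈ F k, n ∉ F (k + 1) ∧ ∀ i, T i n ∈ F (k + 2) := by
  obtain ⟨c, π, σ, hc, hπσ, hσ, hπ, hker⟩ :=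
    exists_coordinates_of_le (h.anti (show k + 1 ≤ k + 2 by omega))
  let Φ : F k →ₗ[K] (Fin r → Fin c → K) :=
    LinearMap.pi fun i => π ∘ₗ T i ∘ₗ (F k).subtype
  have h1 := LinearMap.finrank_range_add_finrank_ker Φ
  have h2 := Submodule.finrank_le (LinearMap.range Φ)
  rw [Module.finrank_pi_fintype] at h2
  simp only [Module.finrank_fin_fun, Finset.sum_const, Finset.card_univ, Fintype.card_fin,
    smul_eq_mul] at h2
  have h4 : r * finrank K (F (k + 1)) = r * c + r * finrank K (F (k + 2)) := by
    rw [← mul_add, hc]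
  have h5 : finrank K (F (k + 1)) < finrank K ((LinearMap.ker Φ).map (F k).subtype) := by
    rw [Submodule.finrank_map_subtype_eq]
    omega
  obtain ⟨n, hn, hn'⟩ := SetLike.not_le_iff_exists.mp fun hle' =>
    absurd (Submodule.finrank_mono hle') (not_le.mpr h5)
  obtain ⟨⟨n, hnk⟩, hnΦ, rfl⟩ := hn
  refine ⟨n, hnk, hn', fun i => hker _ (h.shift k i n hnk) ?_⟩
  exact congrFun (LinearMap.mem_ker.mp hnΦ) i

theorem finrank_sup_span_singleton {W : Submodule K V} {n : V} (hn : n ∉ W) :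
    finrank K ↥(W ⊔ Submodule.span K {n}) = finrank K W + 1 := by
  have hn0 : n ≠ 0 := fun h => hn (h ▸ W.zero_mem)
  have hd : Disjoint W (Submodule.span K {n}) := by
    rw [Submodule.disjoint_span_singleton' hn0]
    exact hn
  have := Submodule.finrank_sup_add_finrank_inf_eq W (Submodule.span K {n})
  rwa [hd.eq_bot, finrank_bot, finrank_span_singleton hn0] at this

end Filtrations
-- Enlarging a filtration until its layers also decay slowly.
section Improvement

open Module (finrank)

variable {K : Type*} [Field K] {V : Type*} [AddCommGroup V] [Module K V] {r : ℕ}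

/-- The i + 1 drops sum to more than i + 1 and the last is at most 1. Walking back from it, the
first drop met that is at least 2 is followed by one that is at most 1. -/
theorem exists_drop_of_sum_gt (f : ℕ → ℕ) (i : ℕ) (hi : f i ≤ f (i + 1) + 1)
    (h0 : f (i + 1) + (i + 1) < f 0) :
    ∃ j < i, f (j + 1) + 2 ≤ f j ∧ f (j + 1) ≤ f (j + 2) + 1 := by
  induction i with
  | zero => omega
  | succ i ih =>
    by_cases h : f i ≤ f (i + 1) + 1
    · obtain ⟨j, hj, hj'⟩ := ih h (by omega)
      exact ⟨j, by omega, hj'⟩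
    · exact ⟨i, by omega, by omega, hi⟩

/-- Moving one dimension from a layer a to the next layer b keeps growth bounded: b + 1 ≤ r (a - 1).
Given r * b < a, the side condition excludes only a = 1, b = 0. -/
theorem add_one_add_le_mul {r a b : ℕ} (hr : 2 ≤ r) (hab : r * b < a) (h : 0 < b ∨ 2 ≤ a) :
    b + 1 + r ≤ r * a := by
  rcases Nat.eq_zero_or_pos b with rfl | hb
  · have : 2 ≤ a := by omega
    nlinarith
  · have h1 : 2 * b ≤ r * b := Nat.mul_le_mul_right b hr
    have h2 : r * (2 * b + 1) ≤ r * a := Nat.mul_le_mul_left r (by omega)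
    nlinarith

theorem IsShiftedBy.update {T : Fin r → Module.End K V} {L : ℕ} {F : ℕ → Submodule K V}
    (h : IsShiftedBy T L F) {k : ℕ} (hk : k < L) {n : V} (hn : n ∈ F k)
    (hTn : ∀ i, T i n ∈ F (k + 2)) :
    IsShiftedBy T L (Function.update F (k + 1) (F (k + 1) ⊔ Submodule.span K {n})) := by
  have hle : F (k + 1) ⊔ Submodule.span K {n} ≤ F k :=
    sup_le (h.anti (Nat.le_succ k)) ((Submodule.span_singleton_le_iff_mem n _).mpr hn)
  have hFF' : F ≤ Function.update F (k + 1) (F (k + 1) ⊔ Submodule.span K {n}) :=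
    le_update_self_iff.mpr le_sup_left
  refine ⟨?_, ?_, antitone_nat_of_succ_le fun j => ?_, fun j i x hx => ?_⟩
  · rw [Function.update_of_ne (by omega), h.zero]
  · rw [Function.update_of_ne (by omega), h.last]
  · by_cases hj : j = k
    · subst hj
      rw [Function.update_self, Function.update_of_ne (by omega)]
      exact hle
    · rw [Function.update_of_ne (by omega)]
      exact (h.anti (Nat.le_succ j)).trans (hFF' j)
  · by_cases hj : j = k + 1
    · subst hj
      rw [Function.update_self] at hx
      rw [Function.update_of_ne (by omega)]
      obtain ⟨y, hy, z, hz, rfl⟩ := Submodule.mem_sup.mp hx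
      obtain ⟨c, rfl⟩ := Submodule.mem_span_singleton.mp hz
      rw [map_add, map_smul]
      exact Submodule.add_mem _ (h.shift _ i y hy) (Submodule.smul_mem _ c (hTn i))
    · rw [Function.update_of_ne hj] at hx
      exact hFF' _ (h.shift j i x hx)

/-- The filtration obtained from `F` by adjoining `n` to `F (k + 1)` and repeating the terms
from `F (k + 1)` on. -/
def insertStep (F : ℕ → Submodule K V) (k : ℕ) (n : V) (j : ℕ) : Submodule K V :=
  if j ≤ k then F j else if j = k + 1 then F (k + 1) ⊔ Submodule.span K {n} else F (j - 1)

/-- The term after the enlarged one is the old F_(k+1), which already contains all T_i n, so n needs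
only to lie in F_k. The delay by one index is affordable because F_L vanishes. -/
theorem IsShiftedBy.insertStep {T : Fin r → Module.End K V} {L : ℕ} {F : ℕ → Submodule K V}
    (h : IsShiftedBy T L F) {k : ℕ} (hk : k < L) (hL : F L = ⊥) {n : V} (hn : n ∈ F k) :
    IsShiftedBy T L (insertStep F k n) := by
  have hle : F (k + 1) ⊔ Submodule.span K {n} ≤ F k :=
    sup_le (h.anti (Nat.le_succ k)) ((Submodule.span_singleton_le_iff_mem n _).mpr hn)
  refine ⟨by simp [LocalTruncated.insertStep, h.zero], ?_,
    antitone_nat_of_succ_le fun j => ?_, fun j i x hx => ?_⟩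
  · simp only [LocalTruncated.insertStep]
    rw [if_neg (by omega), if_neg (by omega)]
    exact hL
  · unfold LocalTruncated.insertStep
    rcases lt_trichotomy j k with hj | rfl | hj
    · rw [if_pos (by omega), if_pos (by omega)]
      exact h.anti (Nat.le_succ j)
    · rw [if_neg (by omega), if_pos rfl, if_pos le_rfl]
      exact hle
    · rw [if_neg (by omega), if_neg (by omega), if_neg (by omega)]
      split_ifs with hj'
      · subst hj'
        exact le_sup_left
      · exact h.anti (by omega)
  · unfold LocalTruncated.insertStep at hx ⊢
    rcases lt_trichotomy j k with hj | rfl | hj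
    · rw [if_pos (by omega)] at hx ⊢
      exact h.shift j i x hx
    · rw [if_pos le_rfl] at hx
      rw [if_neg (by omega), if_pos rfl]
      exact Submodule.mem_sup_left (h.shift j i x hx)
    · rw [if_neg (by omega)] at hx
      rw [if_neg (by omega), if_neg (by omega)]
      split_ifs at hx with hj'
      · subst hj'
        exact h.shift k i x (hle hx)
      · exact h.anti (by omega) (h.shift _ i x hx)

/-- Layer k loses a dimension and layer k + 1 gains one, so only the inequality between these two
gets harder; `hb` is that one. -/
theorem GrowthBounded.of_update {F F' : ℕ → Submodule K V} {k : ℕ} (hG : GrowthBounded r F)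
    (hne : ∀ j, j ≠ k + 1 → F' j = F j)
    (hk : finrank K (F' (k + 1)) = finrank K (F (k + 1)) + 1)
    (hb : finrank K (F (k + 1)) + r * finrank K (F (k + 1)) + 1 + r ≤
      r * finrank K (F k) + finrank K (F (k + 2))) : GrowthBounded r F' := by
  intro j
  have hj := hG j
  have hmono : ∀ j, finrank K (F j) ≤ finrank K (F' j) := by
    intro j
    by_cases h : j = k + 1
    · subst h; omega
    · rw [hne j h]
  by_cases h : j = k
  · subst h
    rw [hne j (by omega), hne (j + 2) (by omega), hk, mul_add]
    omega
  · rw [hne (j + 1) (by omega)]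
    have h1 := Nat.mul_le_mul_left r (hmono j)
    have h2 := hmono (j + 2)
    omega

variable [Module.Finite K V]

theorem GrowthBounded.eq_of_eq {F : ℕ → Submodule K V} (hF : Antitone F)
    (hG : GrowthBounded r F) {k : ℕ} (hk : finrank K (F k) = finrank K (F (k + 1))) (m : ℕ) :
    finrank K (F (k + m)) = finrank K (F k) := by
  have h : ∀ m, finrank K (F (k + m)) = finrank K (F (k + m + 1)) := by
    intro m
    induction m with
    | zero => exact hk
    | succ m ih =>
      have h1 := hG (k + m)
      have h2 := Submodule.finrank_mono (hF (show k + m + 1 ≤ k + m + 2 by omega))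
      rw [ih] at h1
      change finrank K (F (k + m + 1)) = finrank K (F (k + m + 2))
      omega
  induction m with
  | zero => rfl
  | succ m ih => rw [← ih, h m, add_assoc]

/-- The layer c_k is split into c_k - 1 and 1. The new inequalities are 1 ≤ r (c_k - 1), from c_k ≥
2, and c_(k+1) ≤ r, from c_(k+1) ≤ 1. -/
theorem GrowthBounded.insertStep {F : ℕ → Submodule K V} (hG : GrowthBounded r F) (hr : 1 ≤ r)
    {k : ℕ} {n : V} (hn : n ∉ F (k + 1))
    (h1 : finrank K (F (k + 1)) + 2 ≤ finrank K (F k))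
    (h2 : finrank K (F (k + 1)) ≤ finrank K (F (k + 2)) + 1) :
    GrowthBounded r (insertStep F k n) := by
  have hlow : ∀ j ≤ k, LocalTruncated.insertStep F k n j = F j := fun j hj => if_pos hj
  have hmid : finrank K (LocalTruncated.insertStep F k n (k + 1)) = finrank K (F (k + 1)) + 1 := by
    have h : LocalTruncated.insertStep F k n (k + 1) = F (k + 1) ⊔ Submodule.span K {n} := by
      simp [LocalTruncated.insertStep]
    rw [h, finrank_sup_span_singleton hn]
  have hhigh : ∀ j, LocalTruncated.insertStep F k n (k + 2 + j) = F (k + 1 + j) := by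
    intro j
    simp only [LocalTruncated.insertStep]
    rw [if_neg (by omega), if_neg (by omega)]
    congr 1
    omega
  intro j
  rcases lt_trichotomy (j + 1) (k + 1) with hj | hj | hj
  · have := hG j
    rw [hlow j (by omega), hlow (j + 1) (by omega)]
    by_cases hjk : j + 2 ≤ k
    · rw [hlow _ hjk]
      exact this
    · have hjk : j + 2 = k + 1 := by omega
      rw [hjk] at this ⊢
      rw [hmid]
      omega
  · obtain rfl : j = k := by omega
    have h3 := hhigh 0
    rw [add_zero, add_zero] at h3
    rw [hlow j le_rfl, hmid, h3]
    have := Nat.mul_le_mul_left r h1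
    simp only [mul_add, mul_one] at this ⊢
    omega
  · obtain ⟨m, rfl⟩ : ∃ m, j = k + 1 + m := ⟨j - (k + 1), by omega⟩
    rw [show k + 1 + m + 1 = k + 2 + m by ring, show k + 1 + m + 2 = k + 2 + (m + 1) by ring,
      hhigh, hhigh]
    rcases Nat.eq_zero_or_pos m with rfl | hm
    · rw [add_zero, hmid, mul_add, show k + 1 + (0 + 1) = k + 2 by ring]
      omega
    · obtain ⟨m, rfl⟩ : ∃ l, m = l + 1 := ⟨m - 1, by omega⟩
      rw [show k + 1 + (m + 1) = k + 2 + m by ring, hhigh]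
      have := hG (k + 1 + m)
      rw [show k + 1 + m + 1 = k + 2 + m by ring, show k + 1 + m + 2 = k + 1 + (m + 1 + 1) by ring]
        at this
      exact this

theorem IsShiftedBy.exists_larger {T : Fin r → Module.End K V} {L : ℕ} {F : ℕ → Submodule K V}
    (h : IsShiftedBy T L F) (hr : 2 ≤ r) (hV : L + 1 ≤ finrank K V) (hG : GrowthBounded r F)
    (hD : ¬ DecayBounded r L F) :
    ∃ F', IsShiftedBy T L F' ∧ GrowthBounded r F' ∧ F < F' := by
  simp only [DecayBounded, not_forall, not_le] at hD
  obtain ⟨k, hkL, hk⟩ := hD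
  have hm1 := Submodule.finrank_mono (h.anti (show k ≤ k + 1 by omega))
  have hm2 := Submodule.finrank_mono (h.anti (show k + 1 ≤ k + 2 by omega))
  obtain ⟨a, ha⟩ := Nat.exists_eq_add_of_le hm1
  obtain ⟨b, hb⟩ := Nat.exists_eq_add_of_le hm2
  have hab : r * b < a := by
    rw [ha, hb] at hk
    simp only [mul_add] at hk
    omega
  by_cases hcase : 0 < b ∨ 2 ≤ a
  · obtain ⟨n, hn, hn', hTn⟩ := h.exists_mem_of_lt hk
    refine ⟨_, h.update hkL hn hTn, hG.of_update (k := k)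
      (fun j hj => Function.update_of_ne hj _ _) ?_ ?_, ?_⟩
    · rw [Function.update_self, finrank_sup_span_singleton hn']
    · have := add_one_add_le_mul hr hab hcase
      rw [ha, hb]
      simp only [mul_add]
      omega
    · rw [lt_update_self_iff, left_lt_sup, Submodule.span_singleton_le_iff_mem]
      exact hn'
  -- The remaining case c_k = 1, c_(k+1) = 0. By bounded growth all later layers vanish, so F_(k+1)
  -- = 0 and the k + 1 layers up to k carry dim V ≥ L + 1 > k + 1. Hence an earlier layer has
  -- dimension at least 2 and can be split.
  · have hb0 : b = 0 := by omega
    have ha1 : a = 1 := by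
      have : r * b = 0 := by simp [hb0]
      omega
    have hconst := hG.eq_of_eq h.anti (k := k + 1) (by rw [hb, hb0]; rfl)
    have hk0 : finrank K (F (k + 1)) = 0 := by
      rw [← hconst (L - k), show k + 1 + (L - k) = L + 1 by omega, h.last, finrank_bot]
    have hF0 : finrank K (F 0) = finrank K V := by rw [h.zero, finrank_top]
    obtain ⟨j, hj, hj1, hj2⟩ := exists_drop_of_sum_gt (fun j => finrank K (F j)) k
      (by omega) (by omega)
    obtain ⟨n, hn, hn'⟩ := SetLike.not_le_iff_exists.mp fun hle : F j ≤ F (j + 1) =>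
      absurd (Submodule.finrank_mono hle) (by omega)
    have hL : F L = ⊥ := by
      rw [← Submodule.finrank_eq_zero (R := K), ← hk0, ← hconst (L - (k + 1)),
        Nat.add_sub_cancel' hkL]
    refine ⟨_, h.insertStep (by omega) hL hn, hG.insertStep (by omega) hn' hj1 hj2, ?_⟩
    refine lt_of_le_of_ne (fun i => ?_) fun heq => hn' ?_
    · unfold LocalTruncated.insertStep
      split_ifs with h1 h2
      · exact le_rfl
      · exact h2 ▸ le_sup_left
      · exact h.anti (by omega)
    · rw [heq]
      simp only [LocalTruncated.insertStep]
      rw [if_neg (by omega), if_pos trivial]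
      exact Submodule.mem_sup_right (Submodule.mem_span_singleton_self n)

theorem IsShiftedBy.sum_finrank_lt {T : Fin r → Module.End K V} {L : ℕ}
    {F F' : ℕ → Submodule K V} (h' : IsShiftedBy T L F') (hlt : F < F') :
    ∑ j ∈ Finset.range (L + 1), finrank K (F j) < ∑ j ∈ Finset.range (L + 1), finrank K (F' j) := by
  obtain ⟨hle, j, hj⟩ := Pi.lt_def.mp hlt
  have hjL : j < L + 1 := by
    by_contra! hjL
    refine hj.ne_bot (le_bot_iff.mp ?_)
    rw [← h'.last]
    exact h'.anti hjL
  exact Finset.sum_lt_sum (fun j _ => Submodule.finrank_mono (hle j))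
    ⟨j, Finset.mem_range.mpr hjL, Submodule.finrank_lt_finrank_of_lt hj⟩

theorem exists_isShiftedBy_growthBounded_decayBounded {T : Fin r → Module.End K V} {L : ℕ}
    (hr : 2 ≤ r) (hV : L + 1 ≤ finrank K V)
    (hT : ∀ w : List (Fin r), w.length = L + 1 → (w.map T).prod = 0) :
    ∃ F, IsShiftedBy T L F ∧ GrowthBounded r F ∧ DecayBounded r L F := by
  -- n bounds how much the sum of the dimensions can still increase; each enlargement uses up at
  -- least one.
  have key : ∀ n (F : ℕ → Submodule K V), IsShiftedBy T L F → GrowthBounded r F →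
      (∑ j ∈ Finset.range (L + 1), finrank K V) ≤
        (∑ j ∈ Finset.range (L + 1), finrank K (F j)) + n →
      ∃ F, IsShiftedBy T L F ∧ GrowthBounded r F ∧ DecayBounded r L F := by
    intro n
    induction n with
    | zero =>
      intro F hF hG hn
      by_contra! hcon
      obtain ⟨F', hF', hG', hlt⟩ := hF.exists_larger hr hV hG (hcon F hF hG)
      have h1 := hF'.sum_finrank_lt hlt
      have h2 : (∑ j ∈ Finset.range (L + 1), finrank K (F' j)) ≤
        ∑ j ∈ Finset.range (L + 1), finrank K V :=
        Finset.sum_le_sum fun j _ => Submodule.finrank_le _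
      omega
    | succ n ih =>
      intro F hF hG hn
      by_cases hD : DecayBounded r L F
      · exact ⟨F, hF, hG, hD⟩
      obtain ⟨F', hF', hG', hlt⟩ := hF.exists_larger hr hV hG hD
      have h1 := hF'.sum_finrank_lt hlt
      exact ih F' hF' hG' (by omega)
  exact key _ _ (isShiftedBy_radicalFiltration hT) (growthBounded_radicalFiltration T)
    (Nat.le_add_left _ _)

end Improvement

/-! ### A tuple in general position with respect to a given filtration. -/

section Construction

open Module (finrank)

variable {K : Type*} [Field K] {V : Type*} [AddCommGroup V] [Module K V] [Module.Finite K V]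
  {r L : ℕ}

theorem exists_shift_jointly_injective_surjective {F : ℕ → Submodule K V} (hr : 0 < r)
    (hF0 : F 0 = ⊤) (hFL : F (L + 1) = ⊥) (hF : Antitone F) (hG : GrowthBounded r F)
    (hD : DecayBounded r L F) :
    ∃ S : Fin r → Module.End K V, IsShiftedBy S L F ∧
      (∀ k < L, F (k + 1) ≤ (⨆ i, LinearMap.range (S i)) ⊔ F (k + 2)) ∧
      ∀ k < L, ∀ x ∈ F k, (∀ i, S i x ∈ F (k + 2)) → x ∈ F (k + 1) := by
  choose c π σ hc hπσ hσ hπ hker using fun k => exists_coordinates_of_le (hF (Nat.le_succ k))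
  have hex : ∀ k, ∃ A : Fin r → (Fin (c k) → K) →ₗ[K] (Fin (c (k + 1)) → K), k < L →
      (∀ u, ∃ v : Fin r → Fin (c k) → K, ∑ i, A i (v i) = u) ∧
      ∀ v, (∀ i, A i v = 0) → v = 0 := by
    intro k
    by_cases hk : k < L
    · have h1 := hG k
      have h2 := hD k hk
      have h3 := hc k
      have h4 : c (k + 1) + finrank K (F (k + 2)) = finrank K (F (k + 1)) := hc (k + 1)
      rw [Nat.succ_eq_add_one] at h3
      obtain ⟨A, hA⟩ := exists_linearMaps_jointly_injective_surjective (K := K)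
        (r := r) (a := c k) (b := c (k + 1)) hr
        (by rw [← h3, ← h4] at h2; simp only [mul_add] at h2; omega)
        (by rw [← h3, ← h4] at h1; simp only [mul_add] at h1; omega)
      exact ⟨A, fun _ => hA⟩
    · exact ⟨0, fun h => absurd h hk⟩
  choose A hA using hex
  -- On F_k the summands below k vanish and those above k land in F_(k+2), so modulo F_(k+2) only
  -- the layer map `A k i` remains (`happrox`).
  let S : Fin r → Module.End K V := fun i =>
    ∑ k ∈ Finset.range L, σ (k + 1) ∘ₗ A k i ∘ₗ π k
  have hS : ∀ i x, S i x = ∑ k ∈ Finset.range L, σ (k + 1) (A k i (π k x)) := by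
    intro i x
    simp [S, LinearMap.sum_apply]
  have hlow : ∀ {k l x}, x ∈ F k → l < k → π l x = 0 := fun hx hl => hπ _ _ (hF hl hx)
  have hshift : IsShiftedBy S L F := by
    refine ⟨hF0, hFL, hF, fun k i x hx => ?_⟩
    rw [hS]
    refine Submodule.sum_mem _ fun l _ => ?_
    by_cases hl : l < k
    · rw [hlow hx hl, map_zero, map_zero]
      exact Submodule.zero_mem _
    · exact hF (by omega) (hσ (l + 1) _)
  have happrox : ∀ k < L, ∀ i, ∀ x ∈ F k, S i x - σ (k + 1) (A k i (π k x)) ∈ F (k + 2) := by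
    intro k hk i x hx
    rw [hS, ← Finset.sum_erase_eq_sub (Finset.mem_range.mpr hk)]
    refine Submodule.sum_mem _ fun l hl => ?_
    rcases lt_or_gt_of_ne (Finset.ne_of_mem_erase hl) with hlk | hlk
    · rw [hlow hx hlk, map_zero, map_zero]
      exact Submodule.zero_mem _
    · exact hF (by omega) (hσ (l + 1) _)
  refine ⟨S, hshift, fun k hk x hx => ?_, fun k hk x hx hSx => ?_⟩
  · obtain ⟨v, hv⟩ := (hA k hk).1 (π (k + 1) x)
    have h1 : x - σ (k + 1) (π (k + 1) x) ∈ F (k + 2) :=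
      hker (k + 1) _ (Submodule.sub_mem _ hx (hσ _ _)) (by rw [map_sub, hπσ, sub_self])
    have h2 : ∑ i, S i (σ k (v i)) - σ (k + 1) (π (k + 1) x) ∈ F (k + 2) := by
      rw [← hv, map_sum, ← Finset.sum_sub_distrib]
      refine Submodule.sum_mem _ fun i _ => ?_
      have := happrox k hk i _ (hσ k (v i))
      rwa [hπσ] at this
    have h3 : x = ∑ i, S i (σ k (v i)) + (x - ∑ i, S i (σ k (v i))) := by abel
    rw [h3]
    refine Submodule.add_mem_sup (Submodule.sum_mem _ fun i _ =>
      Submodule.mem_iSup_of_mem i (LinearMap.mem_range_self _ _)) ?_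
    have := Submodule.sub_mem _ h1 h2
    rwa [sub_sub_sub_cancel_right] at this
  · refine hker k x hx ((hA k hk).2 _ fun i => ?_)
    have h1 := Submodule.sub_mem _ (hSx i) (happrox k hk i x hx)
    rw [sub_sub_cancel] at h1
    have h2 := hπ (k + 1) _ h1
    rwa [hπσ] at h2

end Construction
-- The open dense rank condition and its consequences.
section Generic

open Module (finrank)

variable {K : Type*} [Field K] {r L d : ℕ}

/-- The operators on `K ^ d` given by a tuple of matrices. -/
def RepVar.op (x : RepVar K r L d) (i : Fin r) : Module.End K (Fin d → K) :=
  Matrix.toLinAlgEquiv' (x.mat i)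

theorem RepVar.prod_op_apply (x : RepVar K r L d) (w : List (Fin r)) (m : Fin d → K) :
    (w.map x.op).prod m = ((w.map x.mat).prod).mulVec m := by
  have h : (w.map x.op).prod = Matrix.toLinAlgEquiv' ((w.map x.mat).prod) := by
    rw [map_list_prod, List.map_map]
    rfl
  rw [h, Matrix.toLinAlgEquiv'_apply]

theorem RepVar.prod_op_eq_zero (x : RepVar K r L d) (w : List (Fin r)) (hw : w.length = L + 1) :
    (w.map x.op).prod = 0 := by
  refine LinearMap.ext fun m => ?_
  rw [RepVar.prod_op_apply, x.rel w hw, Matrix.zero_mulVec, LinearMap.zero_apply]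

/-- The point of `Rep_d(Λ)` given by a tuple of operators shifting a filtration. -/
def IsShiftedBy.repVar {T : Fin r → Module.End K (Fin d → K)} {F : ℕ → Submodule K (Fin d → K)}
    (h : IsShiftedBy T L F) : RepVar K r L d where
  mat i := Matrix.toLinAlgEquiv'.symm (T i)
  rel w hw := by
    have := congrArg Matrix.toLinAlgEquiv'.symm (h.prod_eq_zero hw)
    rwa [map_list_prod, List.map_map, map_zero] at this

theorem IsShiftedBy.op_repVar {T : Fin r → Module.End K (Fin d → K)}
    {F : ℕ → Submodule K (Fin d → K)} (h : IsShiftedBy T L F) : h.repVar.op = T := by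
  ext1 i
  exact AlgEquiv.apply_symm_apply _ _

/-- The matrix of the map `M ^ r → M` given by all loops, whose image is `J M`. -/
def RepVar.radicalMatrix (x : RepVar K r L d) : Matrix (Fin d) (Fin r × Fin d) K :=
  Matrix.of fun a p => x.mat p.1 a p.2

/-- The matrix of the map which sends an element of `M` to its images under all paths of
length `L`. -/
def RepVar.pathMatrix (x : RepVar K r L d) : Matrix ((Fin L → Fin r) × Fin d) (Fin d) K :=
  Matrix.of fun p b => ((List.ofFn p.1).map x.mat).prod p.2 b

theorem RepVar.radicalMatrix_mulVec (x : RepVar K r L d) (u : Fin r × Fin d → K) :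
    x.radicalMatrix.mulVec u = ∑ i, (x.mat i).mulVec fun b => u (i, b) := by
  ext a
  simp [RepVar.radicalMatrix, Matrix.mulVec, dotProduct, Fintype.sum_prod_type]

theorem RepVar.range_radicalMatrix (x : RepVar K r L d) :
    LinearMap.range x.radicalMatrix.mulVecLin = ⨆ i, LinearMap.range (x.op i) := by
  apply le_antisymm
  · rintro _ ⟨u, rfl⟩
    rw [Matrix.mulVecLin_apply, RepVar.radicalMatrix_mulVec]
    exact Submodule.sum_mem _ fun i _ => Submodule.mem_iSup_of_mem i ⟨_, rfl⟩
  · refine iSup_le fun i => ?_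
    rintro _ ⟨u, rfl⟩
    refine ⟨fun p => if p.1 = i then u p.2 else 0, ?_⟩
    rw [Matrix.mulVecLin_apply, RepVar.radicalMatrix_mulVec,
      Finset.sum_eq_single i (fun j _ hj => by simp [hj]; exact Matrix.mulVec_zero _) (by simp)]
    simp [RepVar.op]

theorem RepVar.mem_ker_pathMatrix (x : RepVar K r L d) (m : Fin d → K) :
    m ∈ LinearMap.ker x.pathMatrix.mulVecLin ↔
      ∀ w : List (Fin r), w.length = L → (w.map x.op).prod m = 0 := by
  rw [LinearMap.mem_ker, Matrix.mulVecLin_apply]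
  have key : ∀ p, x.pathMatrix.mulVec m p = ((List.ofFn p.1).map x.op).prod m p.2 := by
    intro p
    rw [RepVar.prod_op_apply]
    rfl
  constructor
  · rintro h w rfl
    ext a
    have := congrFun h (w.get, a)
    rwa [key, List.ofFn_get] at this
  · intro h
    ext p
    rw [key, h _ (by simp)]
    rfl

theorem RepVar.range_le_ker (x : RepVar K r L d) :
    LinearMap.range x.radicalMatrix.mulVecLin ≤ LinearMap.ker x.pathMatrix.mulVecLin := by
  rw [RepVar.range_radicalMatrix]
  refine iSup_le fun i => ?_
  rintro _ ⟨u, rfl⟩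
  rw [RepVar.mem_ker_pathMatrix]
  intro w hw
  have := x.prod_op_eq_zero (w ++ [i]) (by simp [hw])
  simpa using LinearMap.congr_fun this u

theorem RepVar.isOpen_rank_add_rank :
    IsOpen {x : RepVar K r L d | d ≤ x.radicalMatrix.rank + x.pathMatrix.rank} := by
  have h : {x : RepVar K r L d | d ≤ x.radicalMatrix.rank + x.pathMatrix.rank} =
      -- A lower bound on a sum of ranks is a union, over the ways n + (d - n) of sharing it, of
      -- pairs of separate bounds.
      ⋃ n : ℕ, {x | n ≤ x.radicalMatrix.rank} ∩ {x | d - n ≤ x.pathMatrix.rank} := by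
    ext x
    simp only [Set.mem_iUnion, Set.mem_inter_iff, Set.mem_ofPred_eq]
    exact ⟨fun h => ⟨_, le_rfl, by omega⟩, fun ⟨n, h1, h2⟩ => by omega⟩
  rw [h]
  refine isOpen_iUnion fun n => (RepVar.isOpen_le_rank ?_ n).inter (RepVar.isOpen_le_rank ?_ _)
  · exact fun a p => RepVar.coord_mem_regular p.1 a p.2
  · exact fun p b => RepVar.prod_apply_mem_regular _ _ _

theorem RepVar.exists_path_smul_ne_zero (x : RepVar K r L d)
    (hx : d ≤ x.radicalMatrix.rank + x.pathMatrix.rank) (m : x.Mod)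
    (hm : m ∉ Ring.jacobson (Lam K r L) • (⊤ : Submodule (Lam K r L) x.Mod)) :
    ∃ a ∈ (Ring.jacobson (Lam K r L) ^ L : Ideal (Lam K r L)), a • m ≠ 0 := by
  by_contra! hcon
  have hker : (show Fin d → K from m) ∈ LinearMap.ker x.pathMatrix.mulVecLin := by
    refine (RepVar.mem_ker_pathMatrix x m).mpr ?_
    rintro w rfl
    refine (x.prod_op_apply w m).trans ?_
    exact (x.path_smul w m).symm.trans (hcon _ (Lam.path_mem_jacobson_pow w))
  have heq : LinearMap.range x.radicalMatrix.mulVecLin = LinearMap.ker x.pathMatrix.mulVecLin := by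
    refine Submodule.eq_of_le_of_finrank_le x.range_le_ker ?_
    have := LinearMap.finrank_range_add_finrank_ker x.pathMatrix.mulVecLin
    rw [Module.finrank_fin_fun] at this
    simp only [Matrix.rank] at hx
    omega
  rw [← heq] at hker
  obtain ⟨u, hu⟩ := hker
  rw [Matrix.mulVecLin_apply, RepVar.radicalMatrix_mulVec] at hu
  refine hm (hu ▸ ?_)
  refine Submodule.sum_mem
    (Ring.jacobson (Lam K r L) • (⊤ : Submodule (Lam K r L) x.Mod)) fun i _ => ?_
  let v : x.Mod := fun b => u (i, b)
  have h : Lam.arrow K r L i • v ∈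
      Ring.jacobson (Lam K r L) • (⊤ : Submodule (Lam K r L) x.Mod) :=
    Submodule.smul_mem_smul (Lam.arrow_mem_jacobson i) Submodule.mem_top
  rw [x.arrow_smul] at h
  exact h

/-- Iterated down to F_(L+1) = 0, surjectivity puts F_1 inside JM. Injectivity extends a path one
loop at a time, so any m outside F_1 survives some path of length L. Comparing dimensions with F_1
gives the bound. -/
theorem IsShiftedBy.le_rank_add_rank {y : RepVar K r L d} {F : ℕ → Submodule K (Fin d → K)}
    (h : IsShiftedBy y.op L F)
    (hsurj : ∀ k < L, F (k + 1) ≤ (⨆ i, LinearMap.range (y.op i)) ⊔ F (k + 2))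
    (hinj : ∀ k < L, ∀ x ∈ F k, (∀ i, y.op i x ∈ F (k + 2)) → x ∈ F (k + 1)) :
    d ≤ y.radicalMatrix.rank + y.pathMatrix.rank := by
  have h1 : F 1 ≤ LinearMap.range y.radicalMatrix.mulVecLin := by
    rw [RepVar.range_radicalMatrix]
    have : ∀ k ≤ L, F 1 ≤ (⨆ i, LinearMap.range (y.op i)) ⊔ F (k + 1) := by
      intro k
      induction k with
      | zero => exact fun _ => le_sup_right
      | succ k ih =>
        intro hk
        exact (ih (by omega)).trans (sup_le le_sup_left (hsurj k (by omega)))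
    simpa [h.last] using this L le_rfl
  have h2 : LinearMap.ker y.pathMatrix.mulVecLin ≤ F 1 := by
    intro m hm
    rw [RepVar.mem_ker_pathMatrix] at hm
    by_contra hm1
    have : ∀ k ≤ L, ∃ w : List (Fin r), w.length = k ∧ (w.map y.op).prod m ∉ F (k + 1) := by
      intro k
      induction k with
      | zero => exact fun _ => ⟨[], rfl, by simpa using hm1⟩
      | succ k ih =>
        intro hk
        obtain ⟨w, rfl, hw⟩ := ih (by omega)
        have hwm := h.prod_mem w (k := 0) (x := m) (h.zero ▸ Submodule.mem_top)
        rw [zero_add] at hwm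
        have := mt (hinj _ (by omega) _ hwm) hw
        push Not at this
        obtain ⟨i, hi⟩ := this
        exact ⟨i :: w, by simp, by simpa using hi⟩
    obtain ⟨w, hw, hwm⟩ := this L le_rfl
    exact hwm (hm w hw ▸ Submodule.zero_mem _)
  have h3 := LinearMap.finrank_range_add_finrank_ker y.pathMatrix.mulVecLin
  rw [Module.finrank_fin_fun] at h3
  have h4 := Submodule.finrank_mono h1
  have h5 := Submodule.finrank_mono h2
  simp only [Matrix.rank]
  omega

theorem RepVar.dense_rank_add_rank [Infinite K] (hr : 2 ≤ r) (hd : L + 1 ≤ d) :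
    Dense {x : RepVar K r L d | d ≤ x.radicalMatrix.rank + x.pathMatrix.rank} := by
  rw [dense_iff_inter_open]
  rintro U hU ⟨x, hx⟩
  obtain ⟨F, hF, hG, hD⟩ := exists_isShiftedBy_growthBounded_decayBounded hr
    (by rwa [Module.finrank_fin_fun]) x.prod_op_eq_zero
  obtain ⟨S, hS, hsurj, hinj⟩ := exists_shift_jointly_injective_surjective (by omega)
    hF.zero hF.last hF.anti hG hD
  let line : K → RepVar K r L d := fun t => (hF.add_smul hS t).repVar
  have h0 : line 0 = x := by
    ext1
    funext i
    simp [line, IsShiftedBy.repVar, RepVar.op]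
  have h1 : (line 1).op = S := by
    rw [IsShiftedBy.op_repVar]
    simp
  obtain ⟨t, ht⟩ := RepVar.exists_mem_inter_of_line line x.mat
    (fun i => Matrix.toLinAlgEquiv'.symm (S i - x.op i))
    (fun t i => by simp [line, IsShiftedBy.repVar, RepVar.op]) hU RepVar.isOpen_rank_add_rank
    (s := 0) (t := 1) (h0 ▸ hx)
    (IsShiftedBy.le_rank_add_rank (F := F) (h1 ▸ hS) (h1 ▸ hsurj) (h1 ▸ hinj))
  exact ⟨_, ht⟩

/-- A dense set meets the nonempty open subset of X contained in the component, and a nonempty open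
subset of an irreducible space is dense. -/
theorem generically_of_isOpen_of_dense {X : Type*} [TopologicalSpace X]
    [TopologicalSpace.NoetherianSpace X] {C O : Set X} (hC : C ∈ irreducibleComponents X)
    (hO : IsOpen O) (hd : Dense O) {P : X → Prop} (hP : ∀ x ∈ O, P x) : Generically C P := by
  obtain ⟨U, hU, hUne, hUC⟩ :=
    TopologicalSpace.NoetherianSpace.exists_isOpen_nonempty_subset_irreducibleComponent C hC
  obtain ⟨x, hxU, hxO⟩ := hd.inter_open_nonempty U hU hUne
  have : PreirreducibleSpace C := Subtype.preirreducibleSpace hC.1.isPreirreducible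
  have hopen : IsOpen ((↑) ⁻¹' O : Set C) := hO.preimage continuous_subtype_val
  exact ⟨_, hopen, hopen.dense ⟨⟨x, hUC hxU⟩, hxO⟩, fun x hx => hP x hx⟩

end Generic
end LocalTruncated

theorem corollaryD (K : Type*) [Field K] [IsAlgClosed K] (r L d : ℕ)
    (hr : 2 ≤ r) (hL : 1 ≤ L) (hd : L + 1 < d)
    (C : Set (LocalTruncated.RepVar K r L d))
    (hC : C ∈ irreducibleComponents (LocalTruncated.RepVar K r L d)) :
    LocalTruncated.Generically C (fun x =>
      ∀ m : x.Mod,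
        m ∉ Ring.jacobson (LocalTruncated.Lam K r L) •
          (⊤ : Submodule (LocalTruncated.Lam K r L) x.Mod) →
        ∃ a ∈ (Ring.jacobson (LocalTruncated.Lam K r L) ^ L :
          Ideal (LocalTruncated.Lam K r L)), a • m ≠ 0) ∧
    LocalTruncated.Generically C (fun x =>
      (∃ (n : ℕ) (N : Fin n → Submodule (LocalTruncated.Lam K r L) x.Mod),
        DirectSum.IsInternal N ∧
        ∀ i, LocalTruncated.Indecomposable (LocalTruncated.Lam K r L) (N i) ∧
          LocalTruncated.loewyLength (LocalTruncated.Lam K r L) (N i) = L + 1) ∧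
      ∀ N N' : Submodule (LocalTruncated.Lam K r L) x.Mod, IsCompl N N' →
        LocalTruncated.Indecomposable (LocalTruncated.Lam K r L) N →
        LocalTruncated.loewyLength (LocalTruncated.Lam K r L) N = L + 1) := by
  have hopen := LocalTruncated.RepVar.isOpen_rank_add_rank (K := K) (r := r) (L := L) (d := d)
  have hdense := LocalTruncated.RepVar.dense_rank_add_rank (K := K) hr hd.le
  refine ⟨LocalTruncated.generically_of_isOpen_of_dense hC hopen hdense
    fun x hx => x.exists_path_smul_ne_zero hx,
    LocalTruncated.generically_of_isOpen_of_dense hC hopen hdense fun x hx => ?_⟩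
  have hsummand : ∀ N N' : Submodule (LocalTruncated.Lam K r L) x.Mod, IsCompl N N' →
      LocalTruncated.Indecomposable (LocalTruncated.Lam K r L) N →
      LocalTruncated.loewyLength (LocalTruncated.Lam K r L) N = L + 1 := fun N N' hN hind =>
    LocalTruncated.loewyLength_eq_of_isCompl LocalTruncated.Lam.jacobson_pow_eq_bot
      (x.exists_path_smul_ne_zero hx) hN hind.1
  refine ⟨?_, hsummand⟩
  obtain ⟨n, N, hN, hind⟩ := LocalTruncated.exists_isInternal_indecomposable
    (R := LocalTruncated.Lam K r L) (M := x.Mod)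
  obtain ⟨hindep, hsup⟩ := (DirectSum.isInternal_submodule_iff_iSupIndep_and_iSup_eq_top N).mp hN
  refine ⟨n, N, hN, fun i => ⟨hind i, hsummand _ (⨆ (j) (_ : j ≠ i), N j) ⟨hindep i, ?_⟩ (hind i)⟩⟩
  rw [codisjoint_iff_le_sup, ← hsup]
  refine iSup_le fun j => ?_
  rcases eq_or_ne j i with rfl | hj
  · exact le_sup_left
  · exact le_sup_of_le_right (le_iSup₂_of_le j hj le_rfl)
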